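/- A rectangular diagram is a link diagram in the plane composed of $n$ vertical and $n$ horizontal edges, no two vertical edges collinear and no two horizontal edges collinear, in which the vertical edge passes over the horizontal edge at each crossing; diagrams are considered up to order-preserving changes of the abscissae and of the heights. The following moves are described for horizontal edges; the vertical versions are defined in the same way with the roles of the two directions exchanged. Merge: if two horizontal edges are connected by a single vertical edge, and either they lie at adjacent heights (interior merge) or they are the top and the bottom horizontal edge (exterior merge), then the three edges are amalgamated into a single horizontal edge, which in the exterior case is placed either at the top or at the bottom height. Exchange: if two horizontal edges are not interleaved (the abscissae of their endpoints do not alternate), and either they lie at adjacent heights (interior exchange) or they are the top and the bottom horizontal edge (exterior exchange), then their heights are exchanged. Theorem. There is a rectangular diagram $D$ of the trivial knot, with $8$ vertical and $8$ horizontal edges, such that no merge move (interior or exterior, horizontal or vertical) and no interior exchange move (horizontal or vertical) applies to $D$. The diagram $D$ can be deformed into the trivial rectangular diagram with two vertical and two horizontal edges by a finite sequence of exchange moves and merge moves, and every such sequence begins with, and hence contains, an exterior exchange move. -/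

import Mathlib

/-! ### Polygonal knots in 3-space and their equivalence -/

namespace PolyKnot

/-- Points of 3-space; only the affine structure is used. -/
abbrev Pt : Type := Fin 3 → ℝ

/-- The edges `(v₁,v₂), …, (vₖ₋₁,vₖ), (vₖ,v₁)` of the closed polygon with vertices `v₁, …, vₖ`. -/
def edges (l : List Pt) : List (Pt × Pt) := l.zip (l.rotate 1)

/-- The point set of the closed polygon with the given vertices. -/
def carrier (l : List Pt) : Set Pt := {p | ∃ e ∈ edges l, p ∈ segment ℝ e.1 e.2}

/-- The edge with its first endpoint and without its second one. -/
def halfOpenEdge (e : Pt × Pt) : Set Pt := insert e.1 (openSegment ℝ e.1 e.2)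

/-- The closed polygon is a simple closed curve: no edge is degenerate, and the half-open edges
are pairwise disjoint (so that it is traversed without self-intersection). -/
def IsSimple (l : List Pt) : Prop :=
  3 ≤ l.length ∧ (∀ e ∈ edges l, e.1 ≠ e.2) ∧
    (edges l).Pairwise fun e f => Disjoint (halfOpenEdge e) (halfOpenEdge f)

/-- `J` arises from the polygonal knot `K` by an elementary deformation (a triangle move): an edge
`ab` of `K` is replaced by `ap ∪ pb`, where `a, p, b` are not collinear and the solid triangle `apb`
meets `K` in the edge `ab` only. (Then `J` is a polygonal knot too. As `K` and `J` are point sets,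
the choice of the first vertex, the direction and extra vertices on edges play no role.) -/
def ElementaryDeformation (K J : Set Pt) : Prop :=
  ∃ (a b p : Pt) (m : List Pt),
    IsSimple (a :: b :: m) ∧ K = carrier (a :: b :: m) ∧ J = carrier (a :: p :: b :: m) ∧
    ¬ Collinear ℝ ({a, p, b} : Set Pt) ∧
    convexHull ℝ ({a, p, b} : Set Pt) ∩ K = segment ℝ a b

/-- Combinatorial equivalence of polygonal knots: a finite sequence of elementary deformations
and inverses of such. -/
def Equivalent : Set Pt → Set Pt → Prop := Relation.EqvGen ElementaryDeformation

/-- The trivial knot type: knots equivalent to the boundary of a triangle. -/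
def IsTrivialKnot (K : Set Pt) : Prop :=
  ∃ a b c : Pt, ¬ Collinear ℝ ({a, b, c} : Set Pt) ∧ Equivalent K (carrier [a, b, c])

end PolyKnot

/-! ### Rectangular diagrams -/

/-- A rectangular diagram of a link with `n` vertical and `n` horizontal edges, normalized so that
the edges lie on the lines `x = 0, …, n - 1` and `y = 0, …, n - 1`. It is given by its corners: each
of these lines carries exactly two of them, the endpoints of the edge on this line. At a crossing
the vertical edge passes over the horizontal one. -/
structure RectDiagram (n : ℕ) where
  corners : Finset (Fin n × Fin n)
  col_card : ∀ x : Fin n, (corners.filter fun p => p.1 = x).card = 2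
  row_card : ∀ y : Fin n, (corners.filter fun p => p.2 = y).card = 2

namespace RectDiagram

/-- The point of 3-space over the grid point `p` at level `z`. -/
def lift {n : ℕ} (p : Fin n × Fin n) (z : ℝ) : PolyKnot.Pt := ![((p.1 : ℕ) : ℝ), ((p.2 : ℕ) : ℝ), z]

/-- The link in 3-space represented by the diagram (projected along the third coordinate, seen from
above): the horizontal edges are placed at level `0`, the vertical edges at level `1`, and they are
joined by a segment over each corner. -/
def link {n : ℕ} (D : RectDiagram n) : Set PolyKnot.Pt :=
  {P | ∃ p ∈ D.corners, ∃ q ∈ D.corners, p.2 = q.2 ∧ P ∈ segment ℝ (lift p 0) (lift q 0)} ∪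
  {P | ∃ p ∈ D.corners, ∃ q ∈ D.corners, p.1 = q.1 ∧ P ∈ segment ℝ (lift p 1) (lift q 1)} ∪
  {P | ∃ p ∈ D.corners, P ∈ segment ℝ (lift p 0) (lift p 1)}

/-- The diagram represents the trivial knot. -/
def RepresentsTrivialKnot {n : ℕ} (D : RectDiagram n) : Prop := PolyKnot.IsTrivialKnot D.link

/-- The reflection in the line `x = y` of the arrangement of edges; it is used only to obtain the
vertical moves from the horizontal ones. -/
def transpose {n : ℕ} (D : RectDiagram n) : RectDiagram n where
  corners := D.corners.map (Equiv.prodComm (Fin n) (Fin n)).toEmbedding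
  col_card x := by
    rw [Finset.filter_map, Finset.card_map]
    exact D.row_card x
  row_card y := by
    rw [Finset.filter_map, Finset.card_map]
    exact D.col_card y

/-- Two lines of the grid at adjacent positions. -/
def Adjacent {n : ℕ} (r s : Fin n) : Prop := (r : ℕ) + 1 = s ∨ (s : ℕ) + 1 = r

/-- The first and the last line of the grid, in either order. -/
def Extreme {n : ℕ} (r s : Fin n) : Prop :=
  ((r : ℕ) = 0 ∧ (s : ℕ) + 1 = n) ∨ ((s : ℕ) = 0 ∧ (r : ℕ) + 1 = n)

/-- The endpoints of the horizontal edges at heights `r` and `s` alternate. -/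
def Interleaved {n : ℕ} (D : RectDiagram n) (r s : Fin n) : Prop :=
  ∃ a b c d : Fin n, (a, r) ∈ D.corners ∧ (b, r) ∈ D.corners ∧
    (c, s) ∈ D.corners ∧ (d, s) ∈ D.corners ∧
    ((a < c ∧ c < b ∧ b < d) ∨ (c < a ∧ a < d ∧ d < b))

/-- `E` arises from `D` by exchanging the heights of the non-interleaved horizontal edges at
heights `r` and `s`. -/
def HorizontalExchange {n : ℕ} (r s : Fin n) (D E : RectDiagram n) : Prop :=
  ¬ D.Interleaved r s ∧
    ∀ x y : Fin n, (x, y) ∈ E.corners ↔ (x, Equiv.swap r s y) ∈ D.corners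

/-- `E` arises from `D` by amalgamating the horizontal edges at heights `r` and `s` and the vertical
edge that connects them into a single horizontal edge at height `s`. Here `i` is the abscissa of the
vertical edge; the lines `x = i` and `y = r` become empty and are deleted from the grid. (Since `E`
is a rectangular diagram, the new edge has two distinct endpoints, that is, only one vertical edge
connects the two horizontal ones.) -/
def HorizontalMerge {n : ℕ} (r s : Fin (n + 1)) (D : RectDiagram (n + 1)) (E : RectDiagram n) :
    Prop :=
  ∃ i : Fin (n + 1), r ≠ s ∧ (i, r) ∈ D.corners ∧ (i, s) ∈ D.corners ∧
    ∀ x y : Fin n, (x, y) ∈ E.corners ↔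
      ((i.succAbove x, r.succAbove y) ∈ D.corners ∨
        (r.succAbove y = s ∧ (i.succAbove x, r) ∈ D.corners))

end RectDiagram

/-! ### Merge moves and exchange moves -/

/-- The kinds of moves (each of them comes in a horizontal and a vertical version). -/
inductive MoveKind : Type
  | interiorMerge
  | exteriorMerge
  | interiorExchange
  | exteriorExchange

open RectDiagram in
/-- `Move k D E`: the diagram `E` arises from `D` by a single move of kind `k`. -/
inductive Move : {m n : ℕ} → MoveKind → RectDiagram m → RectDiagram n → Prop
  | interiorHorizontalMerge {n : ℕ} {D : RectDiagram (n + 1)} {E : RectDiagram n}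
      (r s : Fin (n + 1)) (hrs : Adjacent r s) (h : HorizontalMerge r s D E) :
      Move .interiorMerge D E
  | interiorVerticalMerge {n : ℕ} {D : RectDiagram (n + 1)} {E : RectDiagram n}
      (r s : Fin (n + 1)) (hrs : Adjacent r s) (h : HorizontalMerge r s D.transpose E.transpose) :
      Move .interiorMerge D E
  | exteriorHorizontalMerge {n : ℕ} {D : RectDiagram (n + 1)} {E : RectDiagram n}
      (r s : Fin (n + 1)) (hrs : Extreme r s) (h : HorizontalMerge r s D E) :
      Move .exteriorMerge D E
  | exteriorVerticalMerge {n : ℕ} {D : RectDiagram (n + 1)} {E : RectDiagram n}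
      (r s : Fin (n + 1)) (hrs : Extreme r s) (h : HorizontalMerge r s D.transpose E.transpose) :
      Move .exteriorMerge D E
  | interiorHorizontalExchange {n : ℕ} {D E : RectDiagram n}
      (r s : Fin n) (hrs : Adjacent r s) (h : HorizontalExchange r s D E) :
      Move .interiorExchange D E
  | interiorVerticalExchange {n : ℕ} {D E : RectDiagram n}
      (r s : Fin n) (hrs : Adjacent r s) (h : HorizontalExchange r s D.transpose E.transpose) :
      Move .interiorExchange D E
  | exteriorHorizontalExchange {n : ℕ} {D E : RectDiagram n}
      (r s : Fin n) (hrs : Extreme r s) (h : HorizontalExchange r s D E) :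
      Move .exteriorExchange D E
  | exteriorVerticalExchange {n : ℕ} {D E : RectDiagram n}
      (r s : Fin n) (hrs : Extreme r s) (h : HorizontalExchange r s D.transpose E.transpose) :
      Move .exteriorExchange D E

/-- `MoveSeq ks D E`: a sequence of exchange and merge moves, of the kinds listed in `ks` in this
order, deforms `D` into `E`. -/
inductive MoveSeq : {m n : ℕ} → List MoveKind → RectDiagram m → RectDiagram n → Prop
  | nil {n : ℕ} (D : RectDiagram n) : MoveSeq [] D D
  | cons {l m n : ℕ} {k : MoveKind} {ks : List MoveKind}
      {D : RectDiagram l} {E : RectDiagram m} {F : RectDiagram n}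
      (hk : Move k D E) (hks : MoveSeq ks E F) : MoveSeq (k :: ks) D F

/-!
The link of the diagram `hardUnknot` is a closed polygon with integral vertices. Explicit triangle
moves carry it to a triangle; that the solid triangle of a move meets no further edge is certified
by separating planes with integral normal vectors, so that only finitely many inequalities between
integers remain to be evaluated.

In `hardUnknot`, edges on adjacent lines are interleaved, and no edge connects two edges that lie on
adjacent lines or on the first and the last line, in either direction. This excludes every move
except the exterior exchanges, so a sequence of moves leading to another diagram begins with one.
-/

namespace PolyKnot

theorem eq_of_mem_segment_of_mem_segment {E : Type*} [AddCommGroup E] [Module ℝ E] {a p b q : E}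
    (h : ¬ Collinear ℝ ({a, p, b} : Set E)) (hap : q ∈ segment ℝ a p) (hpb : q ∈ segment ℝ p b) :
    q = p := by
  by_contra hqp
  have ha : a ∈ line[ℝ, p, q] :=
    (mem_segment_iff_wbtw.1 hap).symm.right_mem_affineSpan_of_left_ne (Ne.symm hqp)
  have hb : b ∈ line[ℝ, p, q] :=
    (mem_segment_iff_wbtw.1 hpb).right_mem_affineSpan_of_left_ne (Ne.symm hqp)
  exact h (collinear_triple_of_mem_affineSpan_pair ha (left_mem_affineSpan_pair ℝ _ _) hb)

/-! ### Closed polygons as unions of half-open edges -/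

theorem insert_right_halfOpenEdge (e : Pt × Pt) :
    insert e.2 (halfOpenEdge e) = segment ℝ e.1 e.2 := by
  rw [halfOpenEdge, Set.insert_comm, insert_endpoints_openSegment]

theorem halfOpenEdge_subset_segment (e : Pt × Pt) : halfOpenEdge e ⊆ segment ℝ e.1 e.2 :=
  insert_right_halfOpenEdge e ▸ Set.subset_insert _ _

theorem halfOpenEdge_subset_insert_halfOpenEdge_swap (x y : Pt) :
    halfOpenEdge (x, y) ⊆ insert x (halfOpenEdge (y, x)) := by
  rw [insert_right_halfOpenEdge (y, x), segment_symm]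
  exact halfOpenEdge_subset_segment (x, y)

theorem right_notMem_halfOpenEdge {x y : Pt} (h : x ≠ y) : y ∉ halfOpenEdge (x, y) := by
  rintro (rfl | hy)
  · exact h rfl
  · exact h (right_mem_openSegment_iff.1 hy)

theorem edges_rotate (l : List Pt) (k : ℕ) : edges (l.rotate k) = (edges l).rotate k := by
  rw [edges, List.rotate_rotate, Nat.add_comm, ← List.rotate_rotate]
  exact (List.zipWith_rotate_distrib Prod.mk l (l.rotate 1) k (by simp)).symm

theorem carrier_rotate (l : List Pt) (k : ℕ) : carrier (l.rotate k) = carrier l := by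
  simp [carrier, edges_rotate]

theorem IsSimple.rotate {l : List Pt} (h : IsSimple l) (k : ℕ) : IsSimple (l.rotate k) := by
  obtain ⟨hlen, hne, hdisj⟩ := h
  refine ⟨by simpa using hlen, by simpa [edges_rotate] using hne, ?_⟩
  rw [edges_rotate]
  exact ((List.rotate_perm _ k).pairwise_iff fun h => h.symm).2 hdisj

theorem exists_mem_edges_fst_eq {l : List Pt} {e : Pt × Pt} (he : e ∈ edges l) :
    ∃ f ∈ edges l, f.1 = e.2 := by
  have hl : (edges l).map Prod.fst = l := List.map_fst_zip (by simp)
  have h : e.2 ∈ (edges l).map Prod.fst := hl.symm ▸ List.mem_rotate.1 (List.of_mem_zip he).2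
  simpa using h

theorem carrier_eq_iUnion_halfOpenEdge (l : List Pt) :
    carrier l = ⋃ e ∈ edges l, halfOpenEdge e := by
  ext q
  simp only [carrier, Set.mem_ofPred_eq, Set.mem_iUnion, exists_prop]
  constructor
  · rintro ⟨e, he, hq⟩
    rw [← insert_right_halfOpenEdge] at hq
    rcases hq with rfl | hq
    · obtain ⟨f, hf, hfe⟩ := exists_mem_edges_fst_eq he
      exact ⟨f, hf, .inl hfe.symm⟩
    · exact ⟨e, he, hq⟩
  · rintro ⟨e, he, hq⟩
    exact ⟨e, he, halfOpenEdge_subset_segment e hq⟩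

theorem disjoint_convexHull_halfOpenEdge {S : Set Pt} {e : Pt × Pt} (f : Pt →ₗ[ℝ] ℝ)
    (h : ∀ x ∈ S, f x < f e.1 ∧ f x ≤ f e.2) : Disjoint (convexHull ℝ S) (halfOpenEdge e) := by
  refine Set.disjoint_left.2 fun q hqS hq => ?_
  suffices hlt : ∀ x ∈ S, f x < f q from
    lt_irrefl (f q) (convexHull_min hlt (convex_halfSpace_lt f.isLinear _) hqS)
  intro x hx
  obtain ⟨hx₁, hx₂⟩ := h x hx
  rcases hq with rfl | ⟨s, t, hs, ht, hst, rfl⟩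
  · exact hx₁
  · calc f x = s * f x + t * f x := by rw [← add_mul, hst, one_mul]
      _ < s * f e.1 + t * f e.2 := add_lt_add_of_lt_of_le (by gcongr) (by gcongr)
      _ = f (s • e.1 + t • e.2) := by simp

/-! ### Triangle moves -/

/-- The polygonal arc `b, c, m, a` leaves the edge `ab` of the closed polygon `a, b, c, m` free for
a triangle move: the solid triangle `apb` is nondegenerate and meets the arc in `a` and `b` only.
As the arc is the disjoint union of its half-open edges and its end `a`, this is expressed through
half-open edges, the first of which is reversed in order to leave out `b` instead of `c`. -/
structure TriangleIsClear (a p b c : Pt) (m : List Pt) : Prop where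
  not_collinear : ¬ Collinear ℝ ({a, p, b} : Set Pt)
  disjoint : ∀ e ∈ (c, b) :: (c :: m).zip (m ++ [a]),
    Disjoint (convexHull ℝ ({a, p, b} : Set Pt)) (halfOpenEdge e)

namespace TriangleIsClear

variable {a p b c : Pt} {m : List Pt}

theorem disjoint_diff (h : TriangleIsClear a p b c m) :
    ∀ e ∈ (b, c) :: (c :: m).zip (m ++ [a]),
      Disjoint (convexHull ℝ ({a, p, b} : Set Pt) \ {b}) (halfOpenEdge e) := by
  obtain ⟨hcb, hrest⟩ := List.forall_mem_cons.1 h.disjoint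
  refine List.forall_mem_cons.2 ⟨?_, fun e he => (hrest e he).mono_left Set.sdiff_subset⟩
  refine Set.disjoint_left.2 fun q ⟨hq, hqb⟩ hqbc => ?_
  exact Set.disjoint_left.1 hcb hq
    ((halfOpenEdge_subset_insert_halfOpenEdge_swap b c hqbc).resolve_left hqb)

theorem halfOpenEdge_subset_diff (h : TriangleIsClear a p b c m) :
    ∀ e ∈ [(a, b), (a, p), (p, b)],
      halfOpenEdge e ⊆ convexHull ℝ ({a, p, b} : Set Pt) \ {b} := by
  have hsub {x y : Pt} (hx : x ∈ ({a, p, b} : Set Pt)) (hy : y ∈ ({a, p, b} : Set Pt))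
      (hb : b ∉ halfOpenEdge (x, y)) :
      halfOpenEdge (x, y) ⊆ convexHull ℝ ({a, p, b} : Set Pt) \ {b} :=
    Set.subset_sdiff_singleton
      ((halfOpenEdge_subset_segment (x, y)).trans (segment_subset_convexHull hx hy)) hb
  have hbap : b ∉ halfOpenEdge (a, p) := fun hb => h.not_collinear <| by
    rw [Set.pair_comm]
    exact (mem_segment_iff_wbtw.1 (halfOpenEdge_subset_segment _ hb)).collinear
  have hbab := right_notMem_halfOpenEdge (ne₁₃_of_not_collinear h.not_collinear)
  have hbpb := right_notMem_halfOpenEdge (ne₂₃_of_not_collinear h.not_collinear)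
  simp only [List.forall_mem_cons, List.not_mem_nil, false_imp_iff, implies_true, and_true]
  exact ⟨hsub (by simp) (by simp) hbab, hsub (by simp) (by simp) hbap,
    hsub (by simp) (by simp) hbpb⟩

theorem disjoint_sides (h : TriangleIsClear a p b c m) :
    Disjoint (halfOpenEdge (a, p)) (halfOpenEdge (p, b)) := by
  refine Set.disjoint_left.2 fun q hap hpb => ?_
  obtain rfl := eq_of_mem_segment_of_mem_segment h.not_collinear
    (halfOpenEdge_subset_segment _ hap) (halfOpenEdge_subset_segment _ hpb)
  exact right_notMem_halfOpenEdge (ne₁₂_of_not_collinear h.not_collinear) hap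

/-- The sides of the triangle cannot meet the arc `b, c, m, a`, so both polygons are simple exactly
when this arc is. -/
theorem isSimple_insert_iff (h : TriangleIsClear a p b c m) :
    IsSimple (a :: p :: b :: c :: m) ↔ IsSimple (a :: b :: c :: m) := by
  have hside : ∀ e ∈ [(a, b), (a, p), (p, b)], ∀ f ∈ (b, c) :: (c :: m).zip (m ++ [a]),
      Disjoint (halfOpenEdge e) (halfOpenEdge f) := fun e he f hf =>
    (h.disjoint_diff f hf).mono_left (h.halfOpenEdge_subset_diff e he)
  have hsides := h.disjoint_sides
  have hap := ne₁₂_of_not_collinear h.not_collinear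
  have hab := ne₁₃_of_not_collinear h.not_collinear
  have hpb := ne₂₃_of_not_collinear h.not_collinear
  simp only [List.mem_cons, List.not_mem_nil, or_false, forall_eq_or_imp, forall_eq] at hside
  simp only [Prod.forall, IsSimple, List.length_cons, le_add_iff_nonneg_left, zero_le, edges,
    List.rotate_cons_succ, List.cons_append, List.rotate_zero, List.zip_cons_cons, List.mem_cons,
    ne_eq, forall_eq_or_imp, List.pairwise_cons, true_and] at hside ⊢
  tauto

theorem elementaryDeformation (h : TriangleIsClear a p b c m) (hs : IsSimple (a :: b :: c :: m)) :
    ElementaryDeformation (carrier (a :: b :: c :: m)) (carrier (a :: p :: b :: c :: m)) := by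
  refine ⟨a, b, p, c :: m, hs, rfl, rfl, h.not_collinear, Set.Subset.antisymm ?_ ?_⟩
  · rintro q ⟨hqT, hq⟩
    rw [carrier_eq_iUnion_halfOpenEdge] at hq
    obtain ⟨e, he, hqe⟩ := Set.mem_iUnion₂.1 hq
    have he' : e = (a, b) ∨ e ∈ (b, c) :: (c :: m).zip (m ++ [a]) := by simpa [edges] using he
    rcases he' with rfl | he'
    · exact halfOpenEdge_subset_segment _ hqe
    · obtain rfl : q = b := by
        by_contra hqb
        exact Set.disjoint_left.1 (h.disjoint_diff e he') ⟨hqT, hqb⟩ hqe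
      exact right_mem_segment ℝ _ _
  · intro q hq
    exact ⟨segment_subset_convexHull (by simp) (by simp) hq, (a, b), by simp [edges], hq⟩

end TriangleIsClear

/-! ### Polygons with integral vertices -/

/-- Points with integral coordinates; they also serve as normal vectors of planes. -/
abbrev LatticePt : Type := Fin 3 → ℤ

namespace LatticePt

open Matrix

/-- A lattice point as a point of 3-space. -/
def toPt (a : LatticePt) : Pt := fun i => a i

theorem toPt_injective : Function.Injective toPt := fun _ _ h =>
  funext fun i => Int.cast_injective (congrFun h i)

theorem toPt_dotProduct_toPt (n a : LatticePt) : toPt n ⬝ᵥ toPt a = (n ⬝ᵥ a : ℤ) := by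
  simp [dotProduct, toPt]

theorem toPt_zero : toPt 0 = 0 := by
  ext i
  simp [toPt]

theorem toPt_crossProduct (a b : LatticePt) : toPt (a ⨯₃ b) = toPt a ⨯₃ toPt b := by
  ext i
  fin_cases i <;> simp [toPt, cross_apply]

theorem toPt_sub (a b : LatticePt) : toPt (a - b) = toPt a - toPt b := by
  ext i
  simp [toPt]

theorem not_collinear_toPt {a p b : LatticePt} (h : (p - a) ⨯₃ (b - a) ≠ 0) :
    ¬ Collinear ℝ ({toPt a, toPt p, toPt b} : Set Pt) := by
  intro hcol
  obtain ⟨v, hv⟩ := (collinear_iff_of_mem (p₀ := toPt a) (by simp)).1 hcol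
  obtain ⟨r, hr⟩ := hv (toPt p) (by simp)
  obtain ⟨s, hs⟩ := hv (toPt b) (by simp)
  refine h (toPt_injective ?_)
  rw [toPt_crossProduct, toPt_sub, toPt_sub, hr, hs, toPt_zero]
  simp

/-- A plane with normal vector `n` separates the points `S` from the half-open edge `e`: as seen
along `n`, the points of `S` lie before `e.1` and not behind `e.2`. -/
def Separates (n : LatticePt) (S : List LatticePt) (e : LatticePt × LatticePt) : Prop :=
  ∀ x ∈ S, n ⬝ᵥ x < n ⬝ᵥ e.1 ∧ n ⬝ᵥ x ≤ n ⬝ᵥ e.2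

instance (n : LatticePt) (S : List LatticePt) (e : LatticePt × LatticePt) :
    Decidable (Separates n S e) :=
  inferInstanceAs (Decidable (∀ x ∈ S, _))

theorem Separates.disjoint {n : LatticePt} {S : List LatticePt} {e : LatticePt × LatticePt}
    (h : Separates n S e) :
    Disjoint (convexHull ℝ {x | x ∈ S.map toPt}) (halfOpenEdge (e.map toPt toPt)) := by
  refine disjoint_convexHull_halfOpenEdge (dotProductBilin ℝ ℝ (toPt n)) ?_
  rintro _ hx
  obtain ⟨x, hxS, rfl⟩ := List.mem_map.1 hx
  simpa [toPt_dotProduct_toPt] using h x hxS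

/-- The normal vectors among which a plane separating the triangle `apb` from the edge `e` is
sought: those of the plane of the triangle, of the planes parallel to a side of the triangle and to
`e`, and of the planes through a side and perpendicular to the triangle. -/
def normals (a p b : LatticePt) (e : LatticePt × LatticePt) : List LatticePt :=
  let w := (p - a) ⨯₃ (b - a)
  let ns := w :: [p - a, b - p, a - b].flatMap fun s => [s ⨯₃ (e.2 - e.1), s ⨯₃ w]
  ns ++ ns.map (-·)

/-- A decidable criterion for `TriangleIsClear`. -/
def HasClearTriangle (a p b c : LatticePt) (m : List LatticePt) : Prop :=
  (p - a) ⨯₃ (b - a) ≠ 0 ∧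
    ∀ e ∈ (c, b) :: (c :: m).zip (m ++ [a]), ∃ n ∈ normals a p b e, Separates n [a, p, b] e

instance (a p b c : LatticePt) (m : List LatticePt) : Decidable (HasClearTriangle a p b c m) :=
  inferInstanceAs (Decidable (_ ∧ _))

theorem HasClearTriangle.triangleIsClear {a p b c : LatticePt} {m : List LatticePt}
    (h : HasClearTriangle a p b c m) :
    TriangleIsClear (toPt a) (toPt p) (toPt b) (toPt c) (m.map toPt) := by
  refine ⟨not_collinear_toPt h.1, fun e he => ?_⟩
  have hmap : (toPt c, toPt b) :: (toPt c :: m.map toPt).zip (m.map toPt ++ [toPt a]) =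
      ((c, b) :: (c :: m).zip (m ++ [a])).map (Prod.map toPt toPt) := by
    rw [List.map_cons, ← List.zip_map]
    simp
  rw [hmap] at he
  obtain ⟨e', he', rfl⟩ := List.mem_map.1 he
  obtain ⟨n, -, hn⟩ := h.2 e' he'
  have hS : ({toPt a, toPt p, toPt b} : Set Pt) = {x | x ∈ [a, p, b].map toPt} := by ext; simp
  exact hS ▸ hn.disjoint

theorem edges_map_toPt (l : List LatticePt) :
    edges (l.map toPt) = (l.zip (l.rotate 1)).map (Prod.map toPt toPt) := by
  rw [edges, ← List.map_rotate, List.zip_map]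

/-- The edges `e` and `f` are separated by a plane perpendicular to a coordinate axis. -/
def AxisSeparated (e f : LatticePt × LatticePt) : Prop :=
  ∃ n ∈ [![1, 0, 0], ![0, 1, 0], ![0, 0, 1], ![-1, 0, 0], ![0, -1, 0], ![0, 0, -1]],
    Separates n [e.1, e.2] f ∨ Separates n [f.1, f.2] e

instance (e f : LatticePt × LatticePt) : Decidable (AxisSeparated e f) :=
  inferInstanceAs (Decidable (∃ n ∈ _, _))

theorem Separates.disjoint_halfOpenEdge {n : LatticePt} {e f : LatticePt × LatticePt}
    (h : Separates n [e.1, e.2] f) :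
    Disjoint (halfOpenEdge (e.map toPt toPt)) (halfOpenEdge (f.map toPt toPt)) := by
  refine h.disjoint.mono_left ((halfOpenEdge_subset_segment _).trans ?_)
  exact segment_subset_convexHull (by simp) (by simp)

theorem AxisSeparated.disjoint {e f : LatticePt × LatticePt} (h : AxisSeparated e f) :
    Disjoint (halfOpenEdge (e.map toPt toPt)) (halfOpenEdge (f.map toPt toPt)) := by
  obtain ⟨n, -, hn | hn⟩ := h
  exacts [hn.disjoint_halfOpenEdge, hn.disjoint_halfOpenEdge.symm]

theorem isSimple_map_toPt {l : List LatticePt} (hlen : 3 ≤ l.length)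
    (hne : ∀ e ∈ l.zip (l.rotate 1), e.1 ≠ e.2)
    (hsep : (l.zip (l.rotate 1)).Pairwise AxisSeparated) : IsSimple (l.map toPt) := by
  refine ⟨by simpa using hlen, ?_, ?_⟩
  · rw [edges_map_toPt, List.forall_mem_map]
    exact fun e he => toPt_injective.ne (hne e he)
  · rw [edges_map_toPt, List.pairwise_map]
    exact hsep.imp AxisSeparated.disjoint

theorem HasClearTriangle.isSimple_insert_iff {a p b c : LatticePt} {m : List LatticePt}
    (h : HasClearTriangle a p b c m) :
    IsSimple ((a :: p :: b :: c :: m).map toPt) ↔ IsSimple ((a :: b :: c :: m).map toPt) :=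
  h.triangleIsClear.isSimple_insert_iff

theorem HasClearTriangle.equivalent {a p b c : LatticePt} {m : List LatticePt}
    (h : HasClearTriangle a p b c m) (hs : IsSimple ((a :: b :: c :: m).map toPt)) :
    Equivalent (carrier ((a :: b :: c :: m).map toPt))
      (carrier ((a :: p :: b :: c :: m).map toPt)) :=
  .rel _ _ (h.triangleIsClear.elementaryDeformation hs)

/-! ### Sequences of triangle moves -/

/-- A triangle move on a closed polygon, given as a list of vertices that is rotated by `k` places
first: the second vertex is removed, or `p` is inserted as the second vertex. -/
inductive TriangleMove : Type
  | remove (k : ℕ)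
  | insert (k : ℕ) (p : LatticePt)

namespace TriangleMove

/-- The polygon that results from a triangle move, provided that `HasClearTriangle` holds. -/
def result : TriangleMove → List LatticePt → Option (List LatticePt)
  | remove k, l => match l.rotate k with
    | a :: p :: b :: c :: m => if HasClearTriangle a p b c m then some (a :: b :: c :: m) else none
    | _ => none
  | insert k p, l => match l.rotate k with
    | a :: b :: c :: m => if HasClearTriangle a p b c m then some (a :: p :: b :: c :: m) else none
    | _ => none

theorem exists_of_result_remove {k : ℕ} {l l' : List LatticePt}
    (h : (remove k).result l = some l') : ∃ a p b c m, l.rotate k = a :: p :: b :: c :: m ∧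
      HasClearTriangle a p b c m ∧ l' = a :: b :: c :: m := by
  simp only [result] at h
  split at h
  · obtain ⟨hclear, hl'⟩ := Option.ite_none_right_eq_some.1 h
    exact ⟨_, _, _, _, _, ‹l.rotate k = _›, hclear, (Option.some.inj hl').symm⟩
  · contradiction

theorem exists_of_result_insert {k : ℕ} {p : LatticePt} {l l' : List LatticePt}
    (h : (insert k p).result l = some l') : ∃ a b c m, l.rotate k = a :: b :: c :: m ∧
      HasClearTriangle a p b c m ∧ l' = a :: p :: b :: c :: m := by
  simp only [result] at h
  split at h
  · obtain ⟨hclear, hl'⟩ := Option.ite_none_right_eq_some.1 h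
    exact ⟨_, _, _, _, ‹l.rotate k = _›, hclear, (Option.some.inj hl').symm⟩
  · contradiction

theorem isSimple_and_equivalent {t : TriangleMove} {l l' : List LatticePt}
    (h : t.result l = some l') (hs : IsSimple (l.map toPt)) :
    IsSimple (l'.map toPt) ∧ Equivalent (carrier (l.map toPt)) (carrier (l'.map toPt)) := by
  have hrotate (k : ℕ) : IsSimple ((l.rotate k).map toPt) ∧
      carrier ((l.rotate k).map toPt) = carrier (l.map toPt) := by
    rw [List.map_rotate]
    exact ⟨hs.rotate k, carrier_rotate _ k⟩
  cases t with
  | remove k =>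
    obtain ⟨a, p, b, c, m, hl, hclear, rfl⟩ := exists_of_result_remove h
    obtain ⟨hsk, hk⟩ := hl ▸ hrotate k
    have hs' := hclear.isSimple_insert_iff.1 hsk
    exact ⟨hs', hk ▸ .symm _ _ (hclear.equivalent hs')⟩
  | insert k p =>
    obtain ⟨a, b, c, m, hl, hclear, rfl⟩ := exists_of_result_insert h
    obtain ⟨hsk, hk⟩ := hl ▸ hrotate k
    exact ⟨hclear.isSimple_insert_iff.2 hsk, hk ▸ hclear.equivalent hsk⟩

theorem isSimple_and_equivalent_of_foldlM {moves : List TriangleMove} {l l' : List LatticePt}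
    (h : moves.foldlM (fun l t => t.result l) l = some l') (hs : IsSimple (l.map toPt)) :
    IsSimple (l'.map toPt) ∧ Equivalent (carrier (l.map toPt)) (carrier (l'.map toPt)) := by
  induction moves generalizing l with
  | nil =>
    obtain rfl : l = l' := by simpa using h
    exact ⟨hs, .refl _⟩
  | cons t moves ih =>
    rw [List.foldlM_cons] at h
    obtain ⟨l₁, h₁, h₂⟩ := Option.bind_eq_some_iff.1 h
    obtain ⟨hs₁, he₁⟩ := isSimple_and_equivalent h₁ hs
    obtain ⟨hs₂, he₂⟩ := ih h₂ hs₁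
    exact ⟨hs₂, .trans _ _ _ he₁ he₂⟩

theorem isTrivialKnot_of_foldlM {moves : List TriangleMove} {l : List LatticePt}
    {x y z : LatticePt} (h : moves.foldlM (fun l t => t.result l) l = some [x, y, z])
    (hs : IsSimple (l.map toPt)) (hxyz : (y - x) ⨯₃ (z - x) ≠ 0) :
    IsTrivialKnot (carrier (l.map toPt)) :=
  ⟨toPt x, toPt y, toPt z, not_collinear_toPt hxyz, (isSimple_and_equivalent_of_foldlM h hs).2⟩

end TriangleMove

end LatticePt

end PolyKnot

namespace RectDiagram

open PolyKnot LatticePt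

/-! ### The link of a rectangular diagram as a closed polygon -/

/-- The lattice point over the grid point `p` at level `z`. -/
def latticeLift {n : ℕ} (p : Fin n × Fin n) (z : ℤ) : LatticePt := ![(p.1 : ℕ), (p.2 : ℕ), z]

theorem toPt_latticeLift {n : ℕ} (p : Fin n × Fin n) (z : ℤ) :
    toPt (latticeLift p z) = lift p z := by
  ext i
  fin_cases i <;> simp [toPt, latticeLift, lift]

/-- The segment between two lattice points, which are given without an order. -/
def unorientedSegment : Sym2 LatticePt → Set Pt :=
  Sym2.lift ⟨fun a b => segment ℝ (toPt a) (toPt b), fun _ _ => segment_symm ℝ _ _⟩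

/-- The edges of the closed polygon with vertices `l`, without their orientation. -/
def polygonEdges (l : List LatticePt) : Finset (Sym2 LatticePt) :=
  ((l.zip (l.rotate 1)).map fun e => s(e.1, e.2)).toFinset

theorem carrier_eq_iUnion_unorientedSegment (l : List LatticePt) :
    carrier (l.map toPt) = ⋃ e ∈ polygonEdges l, unorientedSegment e := by
  ext P
  simp [carrier, edges_map_toPt, polygonEdges, unorientedSegment]

/-- The edges of the polygonal link of a rectangular diagram. -/
def linkEdges {n : ℕ} (D : RectDiagram n) : Finset (Sym2 LatticePt) :=
  ((D.corners.offDiag.filter fun pq => pq.1.2 = pq.2.2).image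
    fun pq => s(latticeLift pq.1 0, latticeLift pq.2 0)) ∪
  ((D.corners.offDiag.filter fun pq => pq.1.1 = pq.2.1).image
    fun pq => s(latticeLift pq.1 1, latticeLift pq.2 1)) ∪
  D.corners.image fun p => s(latticeLift p 0, latticeLift p 1)

theorem link_eq_iUnion_unorientedSegment {n : ℕ} (D : RectDiagram n) :
    D.link = ⋃ e ∈ D.linkEdges, unorientedSegment e := by
  ext P
  simp only [link, linkEdges, unorientedSegment, Finset.set_biUnion_union,
    Finset.set_biUnion_finset_image, Sym2.lift_mk, toPt_latticeLift, Int.cast_zero, Int.cast_one,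
    Set.mem_union, Set.mem_ofPred_eq, Set.mem_iUnion, Finset.mem_filter, Finset.mem_offDiag,
    exists_prop]
  constructor
  · rintro ((⟨p, hp, q, hq, hpq, hP⟩ | ⟨p, hp, q, hq, hpq, hP⟩) | hP)
    · by_cases hne : p = q
      · subst hne
        rw [segment_same, Set.mem_singleton_iff] at hP
        exact .inr ⟨p, hp, hP ▸ left_mem_segment ℝ _ _⟩
      · exact .inl (.inl ⟨(p, q), ⟨⟨hp, hq, hne⟩, hpq⟩, hP⟩)
    · by_cases hne : p = q
      · subst hne
        rw [segment_same, Set.mem_singleton_iff] at hP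
        exact .inr ⟨p, hp, hP ▸ right_mem_segment ℝ _ _⟩
      · exact .inl (.inr ⟨(p, q), ⟨⟨hp, hq, hne⟩, hpq⟩, hP⟩)
    · exact .inr hP
  · rintro ((⟨⟨p, q⟩, ⟨⟨hp, hq, -⟩, hpq⟩, hP⟩ | ⟨⟨p, q⟩, ⟨⟨hp, hq, -⟩, hpq⟩, hP⟩) | hP)
    exacts [.inl (.inl ⟨p, hp, q, hq, hpq, hP⟩), .inl (.inr ⟨p, hp, q, hq, hpq, hP⟩), .inr hP]

theorem link_eq_carrier {n : ℕ} {D : RectDiagram n} {l : List LatticePt}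
    (h : D.linkEdges = polygonEdges l) : D.link = carrier (l.map toPt) := by
  rw [link_eq_iUnion_unorientedSegment, carrier_eq_iUnion_unorientedSegment, h]

/-! ### Obstructions to moves -/

instance {n : ℕ} (r s : Fin n) : Decidable (Adjacent r s) := inferInstanceAs (Decidable (_ ∨ _))

instance {n : ℕ} (r s : Fin n) : Decidable (Extreme r s) := inferInstanceAs (Decidable (_ ∨ _))

instance {n : ℕ} (D : RectDiagram n) (r s : Fin n) : Decidable (D.Interleaved r s) :=
  -- Testing each corner before choosing the next one avoids a search through all quadruples.
  decidable_of_iff (∃ a, (a, r) ∈ D.corners ∧ ∃ b, (b, r) ∈ D.corners ∧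
    ∃ c, (c, s) ∈ D.corners ∧ ∃ d, (d, s) ∈ D.corners ∧
      ((a < c ∧ c < b ∧ b < d) ∨ (c < a ∧ a < d ∧ d < b))) <| by
    simp only [Interleaved, exists_and_left]

instance {n : ℕ} (r s : Fin n) (D E : RectDiagram n) : Decidable (HorizontalExchange r s D E) :=
  inferInstanceAs (Decidable (_ ∧ _))

/-- The property of a diagram that obstructs the horizontal merge moves and the interior horizontal
exchange moves: horizontal edges at adjacent heights are interleaved, and no vertical edge connects
them or the top edge to the bottom edge. -/
structure IsHorizontallyRigid {n : ℕ} (D : RectDiagram n) : Prop where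
  interleaved : ∀ r s, Adjacent r s → D.Interleaved r s
  notMem_corners : ∀ r s, Adjacent r s ∨ Extreme r s → ∀ i, (i, r) ∈ D.corners → (i, s) ∉ D.corners

namespace IsHorizontallyRigid

theorem not_horizontalMerge {n : ℕ} {D : RectDiagram (n + 1)} {E : RectDiagram n}
    (h : D.IsHorizontallyRigid) {r s : Fin (n + 1)} (hrs : Adjacent r s ∨ Extreme r s) :
    ¬ HorizontalMerge r s D E :=
  fun ⟨i, _, hr, hs, _⟩ => h.notMem_corners r s hrs i hr hs

theorem not_horizontalExchange {n : ℕ} {D E : RectDiagram n} (h : D.IsHorizontallyRigid)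
    {r s : Fin n} (hrs : Adjacent r s) : ¬ HorizontalExchange r s D E :=
  fun he => he.1 (h.interleaved r s hrs)

theorem eq_exteriorExchange_of_move {m n : ℕ} {k : MoveKind} {D : RectDiagram m}
    {E : RectDiagram n} (h : D.IsHorizontallyRigid) (ht : D.transpose.IsHorizontallyRigid)
    (hmove : Move k D E) : k = .exteriorExchange := by
  cases hmove with
  | interiorHorizontalMerge r s hrs hm => exact absurd hm (h.not_horizontalMerge (.inl hrs))
  | interiorVerticalMerge r s hrs hm => exact absurd hm (ht.not_horizontalMerge (.inl hrs))
  | exteriorHorizontalMerge r s hrs hm => exact absurd hm (h.not_horizontalMerge (.inr hrs))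
  | exteriorVerticalMerge r s hrs hm => exact absurd hm (ht.not_horizontalMerge (.inr hrs))
  | interiorHorizontalExchange r s hrs he => exact absurd he (h.not_horizontalExchange hrs)
  | interiorVerticalExchange r s hrs he => exact absurd he (ht.not_horizontalExchange hrs)
  | exteriorHorizontalExchange => rfl
  | exteriorVerticalExchange => rfl

theorem exists_eq_exteriorExchange_cons_of_moveSeq {m n : ℕ} {ks : List MoveKind}
    {D : RectDiagram m} {E : RectDiagram n} (h : D.IsHorizontallyRigid)
    (ht : D.transpose.IsHorizontallyRigid) (hmn : m ≠ n) (hks : MoveSeq ks D E) :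
    ∃ ks' : List MoveKind, ks = .exteriorExchange :: ks' := by
  cases hks with
  | nil => exact absurd rfl hmn
  | cons hk _ => exact ⟨_, by rw [h.eq_exteriorExchange_of_move ht hk]⟩

end IsHorizontallyRigid

/-! ### A hard diagram of the trivial knot and its simplification -/

/-- The rectangular diagram whose horizontal edge at height `y` has the endpoints with abscissae
`(rows y).1` and `(rows y).2`. -/
def ofRows {n : ℕ} (rows : Fin n → Fin n × Fin n)
    (hcol : ∀ x, (Finset.univ.filter fun y => x = (rows y).1 ∨ x = (rows y).2).card = 2)
    (hrow : ∀ y, (rows y).1 ≠ (rows y).2) : RectDiagram n where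
  corners := Finset.univ.filter fun p => p.1 = (rows p.2).1 ∨ p.1 = (rows p.2).2
  col_card x := by
    refine (congrArg Finset.card ?_).trans
      ((Finset.card_map ⟨Prod.mk x, Prod.mk_right_injective x⟩).trans (hcol x))
    ext ⟨x', y⟩
    simp only [Finset.mem_filter, Finset.mem_univ, true_and, Finset.mem_map,
      Function.Embedding.coeFn_mk, Prod.mk.injEq, exists_eq_right_right]
    grind
  row_card y := by
    refine Finset.card_eq_two.2 ⟨((rows y).1, y), ((rows y).2, y), by simpa using hrow y, ?_⟩
    ext ⟨x, y'⟩
    simp only [Finset.mem_filter, Finset.mem_univ, true_and, Finset.mem_insert, Prod.mk.injEq,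
      Finset.mem_singleton]
    grind

/-- A diagram of the trivial knot to which no merge move and no interior exchange move applies. -/
def hardUnknot : RectDiagram 8 :=
  ofRows ![(3, 7), (1, 5), (0, 2), (1, 4), (0, 3), (2, 6), (5, 7), (4, 6)]
    (by decide +kernel) (by decide +kernel)

/-- `hardUnknot` with the top and the bottom edge exchanged. -/
def hardUnknotExchanged : RectDiagram 8 :=
  ofRows ![(4, 6), (1, 5), (0, 2), (1, 4), (0, 3), (2, 6), (5, 7), (3, 7)]
    (by decide +kernel) (by decide +kernel)

/-- `hardUnknotExchanged` with the edges at heights `6` and `7` merged. -/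
def unknotSeven : RectDiagram 7 :=
  ofRows ![(4, 6), (1, 5), (0, 2), (1, 4), (0, 3), (2, 6), (3, 5)]
    (by decide +kernel) (by decide +kernel)

/-- `unknotSeven` with the edges at heights `5` and `6` exchanged. -/
def unknotSevenExchanged : RectDiagram 7 :=
  ofRows ![(4, 6), (1, 5), (0, 2), (1, 4), (0, 3), (3, 5), (2, 6)]
    (by decide +kernel) (by decide +kernel)

/-- `unknotSevenExchanged` with the top and the bottom edge merged. -/
def unknotSix : RectDiagram 6 :=
  ofRows ![(1, 5), (0, 2), (1, 4), (0, 3), (3, 5), (2, 4)] (by decide +kernel) (by decide +kernel)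

/-- `unknotSix` with the edges at heights `3` and `4` merged. -/
def unknotFive : RectDiagram 5 :=
  ofRows ![(1, 4), (0, 2), (1, 3), (0, 4), (2, 3)] (by decide +kernel) (by decide +kernel)

/-- `unknotFive` with the leftmost and the rightmost edge merged. -/
def unknotFour : RectDiagram 4 :=
  ofRows ![(0, 3), (1, 3), (0, 2), (1, 2)] (by decide +kernel) (by decide +kernel)

/-- `unknotFour` with the edges at heights `0` and `1` merged. -/
def unknotThree : RectDiagram 3 :=
  ofRows ![(0, 1), (0, 2), (1, 2)] (by decide +kernel) (by decide +kernel)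

/-- The trivial diagram. -/
def unknotTwo : RectDiagram 2 :=
  ofRows ![(0, 1), (0, 1)] (by decide +kernel) (by decide +kernel)

theorem exists_moveSeq_hardUnknot :
    ∃ (T : RectDiagram 2) (ks : List MoveKind), MoveSeq ks hardUnknot T := by
  have h₁ : Move .exteriorExchange hardUnknot hardUnknotExchanged :=
    .exteriorHorizontalExchange 7 0 (by decide +kernel) (by decide +kernel)
  have h₂ : Move .interiorMerge hardUnknotExchanged unknotSeven :=
    .interiorHorizontalMerge 6 7 (by decide +kernel) ⟨7, by decide +kernel⟩
  have h₃ : Move .interiorExchange unknotSeven unknotSevenExchanged :=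
    .interiorHorizontalExchange 5 6 (by decide +kernel) (by decide +kernel)
  have h₄ : Move .exteriorMerge unknotSevenExchanged unknotSix :=
    .exteriorHorizontalMerge 0 6 (by decide +kernel) ⟨6, by decide +kernel⟩
  have h₅ : Move .interiorMerge unknotSix unknotFive :=
    .interiorHorizontalMerge 3 4 (by decide +kernel) ⟨3, by decide +kernel⟩
  have h₆ : Move .exteriorMerge unknotFive unknotFour :=
    .exteriorVerticalMerge 0 4 (by decide +kernel) ⟨3, by decide +kernel⟩
  have h₇ : Move .interiorMerge unknotFour unknotThree :=
    .interiorHorizontalMerge 0 1 (by decide +kernel) ⟨3, by decide +kernel⟩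
  have h₈ : Move .interiorMerge unknotThree unknotTwo :=
    .interiorHorizontalMerge 0 1 (by decide +kernel) ⟨0, by decide +kernel⟩
  exact ⟨unknotTwo, _, .cons h₁ <| .cons h₂ <| .cons h₃ <| .cons h₄ <| .cons h₅ <| .cons h₆ <|
    .cons h₇ <| .cons h₈ <| .nil _⟩

theorem isHorizontallyRigid_hardUnknot : hardUnknot.IsHorizontallyRigid :=
  ⟨by decide +kernel, by decide +kernel⟩

theorem isHorizontallyRigid_transpose_hardUnknot : hardUnknot.transpose.IsHorizontallyRigid :=
  ⟨by decide +kernel, by decide +kernel⟩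

/-- The vertices of the link of `hardUnknot` in cyclic order. A triple `(x, x', y)` stands for the
horizontal edge at height `y`, traversed from the abscissa `x` to the abscissa `x'`. -/
def hardUnknotPolygon : List LatticePt :=
  [(3, 7, 0), (7, 5, 6), (5, 1, 1), (1, 4, 3), (4, 6, 7), (6, 2, 5), (2, 0, 2), (0, 3, 4)].flatMap
    fun (x, x', y) => [![x, y, 1], ![x, y, 0], ![x', y, 0], ![x', y, 1]]

theorem link_hardUnknot : hardUnknot.link = carrier (hardUnknotPolygon.map toPt) :=
  link_eq_carrier (by decide +kernel)

theorem isSimple_hardUnknotPolygon : IsSimple (hardUnknotPolygon.map toPt) :=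
  isSimple_map_toPt (by decide +kernel) (by decide +kernel) (by decide +kernel)

open TriangleMove in
/-- Triangle moves that lead from `hardUnknotPolygon` to a triangle, found by computer search. -/
def hardUnknotMoves : List TriangleMove :=
  [remove 1, remove 8, remove 17, remove 7, remove 19, remove 13, remove 8, remove 8, remove 11,
    remove 0, remove 6, remove 5, remove 15, remove 7, insert 7 ![7, 6, 3], remove 18, remove 17,
    remove 16, insert 13 ![4, -1, -3], remove 16, remove 15, remove 12, remove 5, remove 0,
    remove 7, remove 10, remove 0, remove 8, remove 0, remove 6, remove 3, remove 4, remove 0]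

theorem foldlM_hardUnknotMoves : hardUnknotMoves.foldlM (fun l t => t.result l) hardUnknotPolygon =
    some [![4, 3, 0], ![2, 2, 0], ![1, 3, 1]] := by
  decide +kernel

theorem representsTrivialKnot_hardUnknot : hardUnknot.RepresentsTrivialKnot := by
  rw [RepresentsTrivialKnot, link_hardUnknot]
  exact TriangleMove.isTrivialKnot_of_foldlM foldlM_hardUnknotMoves isSimple_hardUnknotPolygon
    (by decide)

end RectDiagram

/-- There is a rectangular diagram of the trivial knot with 8 vertical edges on which no merge move
and no interior exchange move applies; it can be deformed by exchange and merge moves into the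
trivial rectangular diagram (the one with two vertical and two horizontal edges), and every sequence
of such moves that does this begins with, and so contains, an exterior exchange move. -/
theorem mainTheorem4 :
    ∃ D : RectDiagram 8, D.RepresentsTrivialKnot ∧
      (∀ (n : ℕ) (E : RectDiagram n), ¬ Move .interiorMerge D E ∧ ¬ Move .exteriorMerge D E ∧
        ¬ Move .interiorExchange D E) ∧
      (∃ (T : RectDiagram 2) (ks : List MoveKind), MoveSeq ks D T) ∧
      (∀ (T : RectDiagram 2) (ks : List MoveKind), MoveSeq ks D T →
        ∃ ks' : List MoveKind, ks = .exteriorExchange :: ks') := by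
  have h := RectDiagram.isHorizontallyRigid_hardUnknot
  have ht := RectDiagram.isHorizontallyRigid_transpose_hardUnknot
  have hmove {n : ℕ} {k : MoveKind} {E : RectDiagram n} (hk : k ≠ .exteriorExchange) :
      ¬ Move k RectDiagram.hardUnknot E := fun hm => hk (h.eq_exteriorExchange_of_move ht hm)
  exact ⟨RectDiagram.hardUnknot, RectDiagram.representsTrivialKnot_hardUnknot,
    fun _ _ => ⟨hmove nofun, hmove nofun, hmove nofun⟩, RectDiagram.exists_moveSeq_hardUnknot,
    fun _ _ => h.exists_eq_exteriorExchange_cons_of_moveSeq ht (by decide)⟩
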